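/- Let $\mathcal A$ be a unital pro-$C^*$-algebra, i.e. a complete Hausdorff complex topological $*$-algebra with unit whose topology is determined by the set $S(\mathcal A)$ of its continuous $C^*$-seminorms. Let $\mathcal X$ be a (left) Hilbert $\mathcal A$-module, with $\mathcal A$-valued inner product $\langle\cdot,\cdot\rangle$ linear in the first variable, and put $\bar p(\xi)=\sqrt{p(\langle\xi,\xi\rangle)}$ for $p\in S(\mathcal A)$, $\xi\in\mathcal X$; $\mathcal X$ is complete for the topology given by the seminorms $\bar p$. An $\mathcal A$-module map $T$ on $\mathcal X$ is bounded if for every $p\in S(\mathcal A)$ there is $M_p>0$ with $\bar p(T\xi)\le M_p\,\bar p(\xi)$ for all $\xi$; let $Hom^*_{\mathcal A}(\mathcal X)$ be the set of bounded $\mathcal A$-module maps $T$ on $\mathcal X$ that have an adjoint $T^*$, and put $\bar p(T)=\sup\{\bar p(T\xi):\bar p(\xi)\le 1\}$. Let $l^2(\mathcal X)$ be the set of families $(\xi_i)_{i\in I}$ in $\mathcal X$ for which $\sum_i\langle\xi_i,\xi_i\rangle$ converges in $\mathcal A$, with inner product $\langle(\xi_i),(\eta_i)\rangle=\sum_i\langle\xi_i,\eta_i\rangle$.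 Let $I$ be countable and let $(T_i)_{i\in I}$ in $Hom^*_{\mathcal A}(\mathcal X)$ be a $*$-operator frame with bounds $A,B$, that is, $A$ and $B$ are invertible elements of $\mathcal A$ and for every $\xi\in\mathcal X$ the sum $\sum_i\langle T_i\xi,T_i\xi\rangle$ converges in $\mathcal A$ and $$A\langle\xi,\xi\rangle A^*\le\sum_{i\in I}\langle T_i\xi,T_i\xi\rangle\le B\langle\xi,\xi\rangle B^*.$$ Then $R\xi=(T_i\xi)_{i\in I}$ maps $\mathcal X$ into $l^2(\mathcal X)$ and has an adjoint $R^*:l^2(\mathcal X)\to\mathcal X$; for every $\xi$ the series $\sum_i T_i^*T_i\xi$ converges in $\mathcal X$, and the $*$-frame operator $S\xi=R^*R\xi=\sum_{i\in I}T_i^*T_i\xi$ belongs to $Hom^*_{\mathcal A}(\mathcal X)$; $S$ is bounded, positive ($\langle S\xi,\xi\rangle\ge 0$ for all $\xi$), self-adjoint ($S^*=S$), and invertible in $Hom^*_{\mathcal A}(\mathcal X)$. Moreover $\bar p(S)\le p(B)^2$ for every $p\in S(\mathcal A)$, and $p(A^{-1})^{-2}\le\bar p(S)$ for every $p\in S(\mathcal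 A)$ for which $\bar p$ is not identically zero on $\mathcal X$. -/

import Mathlib

/-- `S(𝒜)`: the set of all continuous C⋆-seminorms on a complex topological ⋆-algebra. -/
def ContCStarSeminorms (𝒜 : Type*) [Ring 𝒜] [StarRing 𝒜] [Algebra ℂ 𝒜] [TopologicalSpace 𝒜] :
    Set (Seminorm ℂ 𝒜) :=
  {p | Continuous p ∧ (∀ a b : 𝒜, p (a * b) ≤ p a * p b) ∧ ∀ a : 𝒜, p (star a * a) = p a ^ 2}

/-- Unital pro-C⋆-algebras: complete Hausdorff complex topological ⋆-algebras with unit whose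
topology is determined by the continuous C⋆-seminorms, i.e. a net (filter) converges to `0` if and
only if `p` of it converges to `0` for all `p ∈ S(𝒜)`. The uniform structure is the one of the
additive topological group. -/
class IsProCStarAlgebra (𝒜 : Type*) [Ring 𝒜] [StarRing 𝒜] [Algebra ℂ 𝒜] [UniformSpace 𝒜] : Prop
    extends StarModule ℂ 𝒜, IsUniformAddGroup 𝒜, IsTopologicalRing 𝒜, ContinuousStar 𝒜,
      ContinuousSMul ℂ 𝒜, T2Space 𝒜, CompleteSpace 𝒜 where
  nhds_zero_eq : nhds (0 : 𝒜) =
    ⨅ p : ContCStarSeminorms 𝒜, Filter.comap (fun a : 𝒜 => p.1 a) (nhds (0 : ℝ))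

/-- The seminorm `p̄(ξ) = √(p ⟨ξ, ξ⟩)` on a space with an `𝒜`-valued inner product. -/
noncomputable def innerSeminorm {𝒜 X : Type*} [Ring 𝒜] [Algebra ℂ 𝒜] [Inner 𝒜 X]
    (p : Seminorm ℂ 𝒜) (ξ : X) : ℝ :=
  Real.sqrt (p (inner 𝒜 ξ ξ))

/-- Hilbert (left) modules over a unital pro-C⋆-algebra `𝒜`. The `𝒜`-valued inner product is linear
in its first variable. The uniform structure of `X` is the one of the additive topological group
whose topology is determined by the seminorms `p̄`, `p ∈ S(𝒜)`, and `X` is complete for it. -/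
class HilbertProCStarModule (𝒜 X : Type*) [Ring 𝒜] [StarRing 𝒜] [Algebra ℂ 𝒜] [PartialOrder 𝒜]
    [UniformSpace 𝒜] [AddCommGroup X] [Module ℂ X] [Module 𝒜 X] [UniformSpace X]
    extends Inner 𝒜 X, IsScalarTower ℂ 𝒜 X, IsUniformAddGroup X, CompleteSpace X where
  inner_add_left : ∀ ξ ξ' η : X, inner (ξ + ξ') η = inner ξ η + inner ξ' η
  inner_smul_left : ∀ (a : 𝒜) (ξ η : X), inner (a • ξ) η = a * inner ξ η
  inner_complex_smul_left : ∀ (z : ℂ) (ξ η : X), inner (z • ξ) η = z • inner ξ η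
  star_inner : ∀ ξ η : X, star (inner ξ η) = inner η ξ
  inner_self_nonneg : ∀ ξ : X, 0 ≤ inner ξ ξ
  inner_self_eq_zero : ∀ ξ : X, inner ξ ξ = 0 ↔ ξ = 0
  nhds_zero_eq : nhds (0 : X) =
    ⨅ p : ContCStarSeminorms 𝒜, Filter.comap (fun ξ : X => innerSeminorm p.1 ξ) (nhds (0 : ℝ))

section Operators

variable {𝒜 X Y I : Type*} [Ring 𝒜] [StarRing 𝒜] [Algebra ℂ 𝒜] [PartialOrder 𝒜] [UniformSpace 𝒜]
  [AddCommGroup X] [Module ℂ X] [Module 𝒜 X] [UniformSpace X] [HilbertProCStarModule 𝒜 X]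
  [AddCommGroup Y] [Module ℂ Y] [Module 𝒜 Y] [UniformSpace Y] [HilbertProCStarModule 𝒜 Y]

/-- Boundedness: for all `p ∈ S(𝒜)` there is `M > 0` with `p̄(T ξ) ≤ M p̄(ξ)` for all `ξ`. -/
def IsBoundedOperator (T : X →ₗ[𝒜] Y) : Prop :=
  ∀ p ∈ ContCStarSeminorms 𝒜, ∃ M : ℝ, 0 < M ∧
    ∀ ξ : X, innerSeminorm p (T ξ) ≤ M * innerSeminorm p ξ

variable (𝒜 X Y I) in
/-- `Hom⋆_𝒜(X, Y)`: bounded `𝒜`-module maps `T` that have an adjoint. -/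
structure AdjointableOperator extends X →ₗ[𝒜] Y where
  bounded : IsBoundedOperator toLinearMap
  adjointable : ∃ T' : Y → X, ∀ (ξ : X) (η : Y), inner 𝒜 (toFun ξ) η = inner 𝒜 ξ (T' η)

instance : CoeFun (AdjointableOperator 𝒜 X Y) (fun _ => X → Y) := ⟨fun T => T.toLinearMap⟩

/-- The adjoint `T⋆` of `T` (unique, since the inner product is definite). -/
noncomputable def AdjointableOperator.adj (T : AdjointableOperator 𝒜 X Y) : Y → X :=
  T.adjointable.choose

theorem AdjointableOperator.inner_adj (T : AdjointableOperator 𝒜 X Y) (ξ : X) (η : Y) :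
    inner 𝒜 (T ξ) η = inner 𝒜 ξ (T.adj η) :=
  T.adjointable.choose_spec ξ η

/-- `p̄(T) = sup {p̄(T ξ) : p̄(ξ) ≤ 1}`, a supremum of a nonempty bounded set of reals. -/
noncomputable def AdjointableOperator.opSeminorm (p : Seminorm ℂ 𝒜)
    (T : AdjointableOperator 𝒜 X Y) : ℝ :=
  sSup {r : ℝ | ∃ ξ : X, innerSeminorm p ξ ≤ 1 ∧ r = innerSeminorm p (T ξ)}

variable (𝒜 X I) in
/-- `l²(X)`: the families `(ξ_i)` in `X` such that `∑ ⟨ξ_i, ξ_i⟩` converges in `𝒜`. Its inner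
product is `⟨ξ, η⟩ = ∑ ⟨ξ_i, η_i⟩`. -/
def l2Families : Set (I → X) :=
  {x | Summable fun i => inner 𝒜 (x i) (x i)}

/-- `(T_i)` is a ⋆-operator frame with lower bound `A` and upper bound `B`, strictly nonzero (that
is, invertible) elements of `𝒜`. The sum converges in the topology of `𝒜`. -/
def IsStarOperatorFrame (T : I → AdjointableOperator 𝒜 X X) (A B : 𝒜ˣ) : Prop :=
  ∀ ξ : X, (Summable fun i => inner 𝒜 (T i ξ) (T i ξ)) ∧
    (A : 𝒜) * inner 𝒜 ξ ξ * star (A : 𝒜) ≤ ∑' i, inner 𝒜 (T i ξ) (T i ξ) ∧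
    ∑' i, inner 𝒜 (T i ξ) (T i ξ) ≤ (B : 𝒜) * inner 𝒜 ξ ξ * star (B : 𝒜)

/-- The ⋆-operator frame transform `R ξ = (T_i ξ)_i`. -/
def frameTransform (T : I → AdjointableOperator 𝒜 X X) (ξ : X) : I → X := fun i => T i ξ

/-- The ⋆-frame operator `S ξ = ∑ T_i⋆ T_i ξ`. -/
noncomputable def frameOperator (T : I → AdjointableOperator 𝒜 X X) (ξ : X) : X :=
  ∑' i, (T i).adj (T i ξ)

/-- `R'` is the adjoint of the frame transform `R : X → l²(X)`: for all `ξ ∈ X` and `x ∈ l²(X)` the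
series `⟨R ξ, x⟩ = ∑ ⟨(R ξ)_i, x_i⟩` converges and equals `⟨ξ, R' x⟩`. -/
def IsTransformAdjoint (T : I → AdjointableOperator 𝒜 X X) (R' : l2Families 𝒜 X I → X) : Prop :=
  ∀ (ξ : X) (x : l2Families 𝒜 X I),
    HasSum (fun i => inner 𝒜 (frameTransform T ξ i) (x.1 i)) (inner 𝒜 ξ (R' x))

end Operators

/-! Everything is estimated one seminorm `p` at a time. The completion of the algebra for `p` is a
C⋆-algebra, so `p` is monotone on positive elements (`Seminorm.le_of_nonneg_of_le`). This yields a
Cauchy–Schwarz inequality for finite families (`map_sum_inner_sq_le`), which together with the upper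
frame bound gives convergence of `∑ T_i⋆ x_i` on `l²(X)`, hence the adjoint of the transform, and
`p̄(Sξ) ≤ p(B)² p̄(ξ)`. Conjugating the lower frame bound by `A⁻¹` gives coercivity, `p̄(ξ)² ≤
p(A⁻¹)² p(⟨Sξ, ξ⟩)`, and so `p̄(ξ) ≤ p(A⁻¹)² p̄(Sξ)`.

Invertibility avoids spectral theory. By the two-sided bounds and completeness, `S` has closed
range. For density, `(S + c)ξ = η` is solved approximately in `p̄` by a contracting iteration, using
positivity of `S`; coercivity bounds `ξ` independently of `c`, so the term `cξ` is negligible for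
small `c`. A symmetric surjective `S` then has a symmetric inverse, which is automatically linear
and adjointable. -/

open UniformSpace Filter Topology

/-! ### Completion for one C⋆-seminorm, and monotonicity on positive elements. -/

section CStarCompletion

variable {E : Type*} [SeminormedRing E] [StarRing E]

/-- Cancel `‖a‖` in `‖a‖² = ‖a⋆a‖ ≤ ‖a⋆‖ ‖a‖`, then exchange `a` and `a⋆`. -/
theorem norm_star_of_norm_star_mul_self (h : ∀ a : E, ‖star a * a‖ = ‖a‖ ^ 2) (a : E) :
    ‖star a‖ = ‖a‖ := by
  have key : ∀ a : E, ‖a‖ ≤ ‖star a‖ := fun a => by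
    have h1 : ‖a‖ ^ 2 ≤ ‖star a‖ * ‖a‖ := h a ▸ norm_mul_le _ _
    rcases (norm_nonneg a).eq_or_lt with h0 | h0
    · exact h0 ▸ norm_nonneg _
    · rw [sq] at h1
      exact le_of_mul_le_mul_right h1 h0
  exact le_antisymm (by simpa using key (star a)) (key a)

theorem uniformContinuous_star_of_norm_star_mul_self (h : ∀ a : E, ‖star a * a‖ = ‖a‖ ^ 2) :
    UniformContinuous (star : E → E) :=
  (AddMonoidHomClass.isometry_of_norm (starAddEquiv : E ≃+ E)
    (norm_star_of_norm_star_mul_self h)).uniformContinuous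

/-- The star ring structure on the completion of a ⋆-algebra for a C⋆-seminorm. -/
noncomputable abbrev starRingCompletion (h : ∀ a : E, ‖star a * a‖ = ‖a‖ ^ 2) :
    StarRing (Completion E) :=
  have hu := uniformContinuous_star_of_norm_star_mul_self h
  have hc : Continuous (Completion.map (star : E → E)) := Completion.continuous_map
  { star := Completion.map star
    star_involutive := fun x => by
      refine Completion.induction_on x ?_ fun a => ?_
      · exact isClosed_eq (hc.comp hc) continuous_id
      · rw [Completion.map_coe hu, Completion.map_coe hu, star_star]
    star_mul := fun x y => by
      change Completion.map star (x * y) = Completion.map star y * Completion.map star x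
      refine Completion.induction_on₂ x y ?_ fun a b => ?_
      · exact isClosed_eq (hc.comp continuous_mul)
          ((hc.comp continuous_snd).mul (hc.comp continuous_fst))
      · rw [← Completion.coe_mul, Completion.map_coe hu, Completion.map_coe hu,
          Completion.map_coe hu, star_mul, Completion.coe_mul]
    star_add := fun x y => by
      change Completion.map star (x + y) = Completion.map star x + Completion.map star y
      refine Completion.induction_on₂ x y ?_ fun a b => ?_
      · exact isClosed_eq (hc.comp continuous_add)
          ((hc.comp continuous_fst).add (hc.comp continuous_snd))
      · rw [← Completion.coe_add, Completion.map_coe hu, Completion.map_coe hu,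
          Completion.map_coe hu, star_add, Completion.coe_add] }

/-- The completion of a complex ⋆-algebra with respect to a C⋆-seminorm is a C⋆-algebra. -/
noncomputable abbrev cstarAlgebraCompletion [NormedAlgebra ℂ E] [StarModule ℂ E]
    (h : ∀ a : E, ‖star a * a‖ = ‖a‖ ^ 2) : CStarAlgebra (Completion E) :=
  have hu := uniformContinuous_star_of_norm_star_mul_self h
  have hc : Continuous (Completion.map (star : E → E)) := Completion.continuous_map
  { starRingCompletion h with
    norm_mul_self_le := fun x => by
      change _ ≤ ‖Completion.map star x * x‖
      refine Completion.induction_on x ?_ fun a => ?_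
      · exact isClosed_le (continuous_norm.mul continuous_norm)
          (hc.mul continuous_id).norm
      · rw [Completion.map_coe hu, ← Completion.coe_mul, Completion.norm_coe,
          Completion.norm_coe, h, sq]
    norm_smul_le := fun z x => by
      refine Completion.induction_on x ?_ fun a => ?_
      · exact isClosed_le (continuous_const_smul z).norm (continuous_const.mul continuous_norm)
      · rw [← Completion.coe_smul, Completion.norm_coe, Completion.norm_coe, norm_smul]
    star_smul := fun z x => by
      change Completion.map star (z • x) = star z • Completion.map star x
      refine Completion.induction_on x ?_ fun a => ?_
      · exact isClosed_eq (hc.comp (continuous_const_smul z)) (hc.const_smul (star z))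
      · rw [← Completion.coe_smul, Completion.map_coe hu, Completion.map_coe hu, star_smul,
          Completion.coe_smul] }

/-- The canonical map to the completion is a norm-preserving ⋆-homomorphism, hence monotone for the
star order, and the claim is known in the C⋆-algebra. -/
theorem norm_le_norm_of_nonneg_of_le_of_norm_star_mul_self [NormedAlgebra ℂ E] [StarModule ℂ E]
    [PartialOrder E] [StarOrderedRing E] (h : ∀ a : E, ‖star a * a‖ = ‖a‖ ^ 2)
    {a b : E} (ha : 0 ≤ a) (hab : a ≤ b) : ‖a‖ ≤ ‖b‖ := by
  let _ := cstarAlgebraCompletion h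
  let _ : PartialOrder (Completion E) := CStarAlgebra.spectralOrder _
  have : StarOrderedRing (Completion E) := CStarAlgebra.spectralOrderedRing _
  let φ : E →⋆ₙ+* Completion E :=
    { (Completion.coeRingHom : E →+* Completion E) with
      map_star' := fun a =>
        (Completion.map_coe (uniformContinuous_star_of_norm_star_mul_self h) a).symm }
  have hφ : ∀ a, ‖φ a‖ = ‖a‖ := Completion.norm_coe
  have h0 : 0 ≤ φ a := by simpa using OrderHomClass.mono φ ha
  simpa only [hφ] using CStarAlgebra.norm_le_norm_of_nonneg_of_le h0 (OrderHomClass.mono φ hab)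

end CStarCompletion

section Seminorm

variable {E : Type*} [Ring E] [StarRing E] [Algebra ℂ E]

/-- The seminormed ring structure given by a submultiplicative C⋆-seminorm. -/
abbrev seminormedRingOfSeminorm (p : Seminorm ℂ E) (hm : ∀ a b : E, p (a * b) ≤ p a * p b) :
    SeminormedRing E :=
  RingSeminorm.toSeminormedRing
    { p.toAddGroupSeminorm with mul_le' := hm }

theorem Seminorm.le_of_nonneg_of_le [StarModule ℂ E] [PartialOrder E] [StarOrderedRing E]
    (p : Seminorm ℂ E) (hm : ∀ a b : E, p (a * b) ≤ p a * p b)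
    (hs : ∀ a : E, p (star a * a) = p a ^ 2) {a b : E} (ha : 0 ≤ a) (hab : a ≤ b) : p a ≤ p b := by
  let _ := seminormedRingOfSeminorm p hm
  let _ : NormedAlgebra ℂ E :=
    { ‹Algebra ℂ E› with norm_smul_le := fun z a => (map_smul_eq_mul p z a).le }
  exact norm_le_norm_of_nonneg_of_le_of_norm_star_mul_self (E := E) hs ha hab

theorem Seminorm.map_star_of_star_mul_self
    (p : Seminorm ℂ E) (hm : ∀ a b : E, p (a * b) ≤ p a * p b)
    (hs : ∀ a : E, p (star a * a) = p a ^ 2) (a : E) : p (star a) = p a :=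
  let _ := seminormedRingOfSeminorm p hm
  norm_star_of_norm_star_mul_self (E := E) hs a

end Seminorm

/-! ### Calculus of continuous C⋆-seminorms. -/

section ContCStarSeminorms

variable {𝒜 : Type*} [Ring 𝒜] [StarRing 𝒜] [Algebra ℂ 𝒜] {p q : Seminorm ℂ 𝒜}

namespace ContCStarSeminorms

section

variable [TopologicalSpace 𝒜]

theorem zero_mem : (0 : Seminorm ℂ 𝒜) ∈ ContCStarSeminorms 𝒜 :=
  ⟨continuous_const, fun _ _ => by simp, fun _ => by simp⟩

theorem sup_mem (hp : p ∈ ContCStarSeminorms 𝒜) (hq : q ∈ ContCStarSeminorms 𝒜) :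
    p ⊔ q ∈ ContCStarSeminorms 𝒜 := by
  refine ⟨hp.1.sup hq.1, fun a b => ?_, fun a => ?_⟩
  · refine max_le ((hp.2.1 a b).trans ?_) ((hq.2.1 a b).trans ?_)
    · exact mul_le_mul (le_max_left _ _) (le_max_left _ _) (apply_nonneg _ _) (apply_nonneg _ _)
    · exact mul_le_mul (le_max_right _ _) (le_max_right _ _) (apply_nonneg _ _) (apply_nonneg _ _)
  · change max (p _) (q _) = max (p a) (q a) ^ 2
    rw [hp.2.2, hq.2.2]
    rcases le_total (p a) (q a) with h | h
    · rw [max_eq_right h, max_eq_right (pow_le_pow_left₀ (apply_nonneg _ _) h 2)]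
    · rw [max_eq_left h, max_eq_left (pow_le_pow_left₀ (apply_nonneg _ _) h 2)]

theorem map_star (hp : p ∈ ContCStarSeminorms 𝒜) (a : 𝒜) : p (star a) = p a :=
  p.map_star_of_star_mul_self hp.2.1 hp.2.2 a

theorem map_mul_star_self (hp : p ∈ ContCStarSeminorms 𝒜) (a : 𝒜) : p (a * star a) = p a ^ 2 := by
  simpa [map_star hp] using hp.2.2 (star a)

theorem map_conj_le (hp : p ∈ ContCStarSeminorms 𝒜) (a b : 𝒜) :
    p (a * b * star a) ≤ p a ^ 2 * p b := by
  have h1 := hp.2.1 (a * b) (star a)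
  have h2 := mul_le_mul_of_nonneg_right (hp.2.1 a b) (apply_nonneg p a)
  rw [map_star hp] at h1
  linarith

theorem map_le_of_nonneg_of_le [StarModule ℂ 𝒜] [PartialOrder 𝒜] [StarOrderedRing 𝒜]
    (hp : p ∈ ContCStarSeminorms 𝒜) {a b : 𝒜} (ha : 0 ≤ a) (hab : a ≤ b) : p a ≤ p b :=
  p.le_of_nonneg_of_le hp.2.1 hp.2.2 ha hab

end

theorem eq_zero_of_forall [UniformSpace 𝒜] [IsProCStarAlgebra 𝒜] {a : 𝒜}
    (h : ∀ p ∈ ContCStarSeminorms 𝒜, p a = 0) : a = 0 := by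
  have : Tendsto (fun _ : ℕ => a) atTop (𝓝 0) := by
    rw [IsProCStarAlgebra.nhds_zero_eq, tendsto_iInf]
    intro p
    rw [tendsto_comap_iff]
    have : (fun a => p.1 a) ∘ (fun _ : ℕ => a) = fun _ => 0 := funext fun _ => h p.1 p.2
    rw [this]
    exact tendsto_const_nhds
  exact tendsto_nhds_unique tendsto_const_nhds this

end ContCStarSeminorms

theorem ofReal_smul_nonneg [StarModule ℂ 𝒜] [PartialOrder 𝒜] [StarOrderedRing 𝒜] {r : ℝ}
    (hr : 0 ≤ r) {a : 𝒜} (ha : 0 ≤ a) : 0 ≤ (r : ℂ) • a := by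
  -- Scaling by `r` is conjugation by `√r • 1`.
  have h := star_left_conjugate_nonneg ha (((Real.sqrt r : ℝ) : ℂ) • (1 : 𝒜))
  have h2 : (Real.sqrt r : ℂ) * (Real.sqrt r : ℂ) = r := by
    rw [← Complex.ofReal_mul, Real.mul_self_sqrt hr]
  simpa only [star_smul, star_one, smul_mul_assoc, one_mul, mul_smul_comm, mul_one, smul_smul,
    Complex.star_def, Complex.conj_ofReal, h2] using h

end ContCStarSeminorms

/-- The scalar optimisation behind Cauchy–Schwarz: `t = 1/Q` is the best choice, and for `Q = 0` a
large `t` forces `u ≤ 0`. -/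
theorem le_mul_of_forall_two_mul_le {u P Q : ℝ} (hQ : 0 ≤ Q)
    (h : ∀ t : ℝ, 0 ≤ t → 2 * t * u ≤ P + t ^ 2 * (u * Q)) : u ≤ P * Q := by
  rcases hQ.eq_or_lt with rfl | hQ
  · by_contra! hlt
    have hu : 0 < u := by simpa using hlt
    have hP : 0 ≤ P := by simpa using h 0 le_rfl
    have := h ((P + 1) / (2 * u)) (by positivity)
    have e : 2 * ((P + 1) / (2 * u)) * u = P + 1 := by field_simp
    rw [e] at this
    linarith
  · have := h (1 / Q) (by positivity)
    have e1 : 2 * (1 / Q) * u = 2 * (u / Q) := by ring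
    have e2 : (1 / Q) ^ 2 * (u * Q) = u / Q := by field_simp
    rw [e1, e2] at this
    exact (div_le_iff₀ hQ).1 (by linarith)

/-! ### Inner product, the seminorms `p̄`, and Cauchy–Schwarz. -/

namespace HilbertProCStarModule

variable {𝒜 X ι : Type*} [Ring 𝒜] [StarRing 𝒜] [Algebra ℂ 𝒜] [PartialOrder 𝒜] [UniformSpace 𝒜]
  [AddCommGroup X] [Module ℂ X] [Module 𝒜 X] [UniformSpace X] [HilbertProCStarModule 𝒜 X]

section Algebraic

variable (𝒜)

theorem inner_add_right (ξ η η' : X) : inner 𝒜 ξ (η + η') = inner 𝒜 ξ η + inner 𝒜 ξ η' := by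
  rw [← star_inner, inner_add_left, star_add, star_inner, star_inner]

/-- The inner product as a biadditive map. -/
def innerAddHom : X →+ X →+ 𝒜 :=
  AddMonoidHom.mk' (fun ξ => AddMonoidHom.mk' (fun η => inner 𝒜 ξ η) (inner_add_right 𝒜 ξ))
    fun ξ ξ' => AddMonoidHom.ext fun η => inner_add_left ξ ξ' η

theorem inner_zero_left (η : X) : inner 𝒜 0 η = 0 :=
  DFunLike.congr_fun (map_zero (innerAddHom 𝒜)) η

theorem inner_sub_left (ξ ξ' η : X) : inner 𝒜 (ξ - ξ') η = inner 𝒜 ξ η - inner 𝒜 ξ' η :=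
  DFunLike.congr_fun (map_sub (innerAddHom 𝒜) ξ ξ') η

theorem inner_sub_right (ξ η η' : X) : inner 𝒜 ξ (η - η') = inner 𝒜 ξ η - inner 𝒜 ξ η' :=
  map_sub (innerAddHom 𝒜 ξ) η η'

theorem inner_sum_left (s : Finset ι) (x : ι → X) (η : X) :
    inner 𝒜 (∑ i ∈ s, x i) η = ∑ i ∈ s, inner 𝒜 (x i) η :=
  map_sum ((innerAddHom 𝒜).flip η) x s

theorem inner_smul_right (a : 𝒜) (ξ η : X) : inner 𝒜 ξ (a • η) = inner 𝒜 ξ η * star a := by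
  rw [← star_inner, inner_smul_left, star_mul, star_inner]

theorem inner_complex_smul_right [StarModule ℂ 𝒜] (z : ℂ) (ξ η : X) :
    inner 𝒜 ξ (z • η) = star z • inner 𝒜 ξ η := by
  rw [← star_inner, inner_complex_smul_left, star_smul, star_inner]

variable {𝒜}

theorem ext_inner_left {ξ ξ' : X} (h : ∀ η : X, inner 𝒜 ξ η = inner 𝒜 ξ' η) : ξ = ξ' := by
  rw [← sub_eq_zero, ← inner_self_eq_zero (𝒜 := 𝒜), inner_sub_left, h, sub_self]

end Algebraic

variable {p q : Seminorm ℂ 𝒜}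

variable (p) in
theorem innerSeminorm_sq (ξ : X) : innerSeminorm p ξ ^ 2 = p (inner 𝒜 ξ ξ) :=
  Real.sq_sqrt (apply_nonneg _ _)

variable (p) in
theorem innerSeminorm_nonneg (ξ : X) : 0 ≤ innerSeminorm p ξ := Real.sqrt_nonneg _

variable (p) in
theorem innerSeminorm_zero : innerSeminorm p (0 : X) = 0 := by
  simp [innerSeminorm, inner_zero_left]

variable (p) in
theorem innerSeminorm_complex_smul [StarModule ℂ 𝒜] (z : ℂ) (ξ : X) :
    innerSeminorm p (z • ξ) = ‖z‖ * innerSeminorm p ξ := by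
  have h : p (inner 𝒜 (z • ξ) (z • ξ)) = ‖z‖ ^ 2 * p (inner 𝒜 ξ ξ) := by
    rw [inner_complex_smul_left, inner_complex_smul_right, map_smul_eq_mul, map_smul_eq_mul,
      norm_star]
    ring
  rw [innerSeminorm, h, Real.sqrt_mul (sq_nonneg _), Real.sqrt_sq (norm_nonneg _), innerSeminorm]

variable (p) in
theorem innerSeminorm_neg [StarModule ℂ 𝒜] (ξ : X) : innerSeminorm p (-ξ) = innerSeminorm p ξ := by
  simpa using innerSeminorm_complex_smul p (-1) ξ

theorem innerSeminorm_mono (h : p ≤ q) (ξ : X) : innerSeminorm p ξ ≤ innerSeminorm q ξ :=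
  Real.sqrt_le_sqrt (h _)

variable (𝒜) in
-- A single seminorm suffices because the C⋆-seminorms are directed under maxima.
theorem mem_nhds_zero_iff {U : Set X} :
    U ∈ 𝓝 (0 : X) ↔
      ∃ p ∈ ContCStarSeminorms 𝒜, ∃ ε > 0, ∀ ξ : X, innerSeminorm p ξ < ε → ξ ∈ U := by
  have : Nonempty (ContCStarSeminorms 𝒜) := ⟨⟨0, ContCStarSeminorms.zero_mem⟩⟩
  have hb : ∀ p : ContCStarSeminorms 𝒜, (comap (fun ξ : X => innerSeminorm p.1 ξ) (𝓝 0)).HasBasis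
      (fun ε : ℝ => 0 < ε) fun ε => {ξ | innerSeminorm p.1 ξ < ε} := fun p => by
    have h := (Metric.nhds_basis_ball (x := (0 : ℝ))).comap fun ξ : X => innerSeminorm p.1 ξ
    refine h.congr (fun _ => Iff.rfl) fun ε _ => ?_
    ext ξ
    simp [abs_of_nonneg (innerSeminorm_nonneg p.1 ξ)]
  rw [nhds_zero_eq (𝒜 := 𝒜), mem_iInf_of_directed]
  · simp only [(hb _).mem_iff, Subtype.exists, exists_prop]
    rfl
  · intro p q
    refine ⟨⟨p.1 ⊔ q.1, ContCStarSeminorms.sup_mem p.2 q.2⟩, ?_, ?_⟩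
    · refine (hb _).ge_iff.2 fun ε hε => (hb _).mem_iff.2 ⟨ε, hε, fun ξ hξ =>
        (innerSeminorm_mono le_sup_left ξ).trans_lt hξ⟩
    · refine (hb _).ge_iff.2 fun ε hε => (hb _).mem_iff.2 ⟨ε, hε, fun ξ hξ =>
        (innerSeminorm_mono le_sup_right ξ).trans_lt hξ⟩

variable (𝒜) in
theorem tendsto_zero_iff {α : Type*} {l : Filter α} {f : α → X} :
    Tendsto f l (𝓝 0) ↔
      ∀ p ∈ ContCStarSeminorms 𝒜, Tendsto (fun a => innerSeminorm p (f a)) l (𝓝 0) := by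
  simp only [nhds_zero_eq (𝒜 := 𝒜), tendsto_iInf, tendsto_comap_iff, Subtype.forall]
  rfl

theorem eq_zero_of_forall_innerSeminorm [IsProCStarAlgebra 𝒜] {ξ : X}
    (h : ∀ p ∈ ContCStarSeminorms 𝒜, innerSeminorm p ξ = 0) : ξ = 0 := by
  rw [← inner_self_eq_zero (𝒜 := 𝒜)]
  refine ContCStarSeminorms.eq_zero_of_forall fun p hp => ?_
  rw [← innerSeminorm_sq, h p hp, zero_pow two_ne_zero]

variable (𝒜 X) in
-- Separation follows from definiteness of the inner product and the Hausdorff property of `𝒜`; it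
-- is needed to make complete subsets closed.
theorem t2Space [IsProCStarAlgebra 𝒜] : T2Space X := by
  have := toIsUniformAddGroup (𝒜 := 𝒜) (X := X)
  have : T0Space X := ⟨fun x y hxy => by
    rw [← sub_eq_zero]
    refine eq_zero_of_forall_innerSeminorm (𝒜 := 𝒜) fun p hp => ?_
    have h : Tendsto (fun _ : ℕ => x) atTop (𝓝 y) := hxy ▸ tendsto_const_nhds
    have h2 := (tendsto_zero_iff 𝒜).1 (tendsto_sub_nhds_zero_iff.2 h) p hp
    exact tendsto_nhds_unique tendsto_const_nhds h2⟩
  infer_instance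

variable [StarOrderedRing 𝒜] [IsProCStarAlgebra 𝒜]

/-- The Cauchy–Schwarz inequality for finite families. -/
theorem map_sum_inner_sq_le (hp : p ∈ ContCStarSeminorms 𝒜) (s : Finset ι) (x y : ι → X) :
    p (∑ i ∈ s, inner 𝒜 (x i) (y i)) ^ 2 ≤
      p (∑ i ∈ s, inner 𝒜 (x i) (x i)) * p (∑ i ∈ s, inner 𝒜 (y i) (y i)) := by
  set b := ∑ i ∈ s, inner 𝒜 (x i) (y i) with hb
  set P := ∑ i ∈ s, inner 𝒜 (x i) (x i)
  set Q := ∑ i ∈ s, inner 𝒜 (y i) (y i)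
  have hb' : ∑ i ∈ s, inner 𝒜 (y i) (x i) = star b := by
    rw [hb, star_sum]
    exact Finset.sum_congr rfl fun i _ => (star_inner _ _).symm
  refine le_mul_of_forall_two_mul_le (apply_nonneg _ _) fun t ht => ?_
  -- With the coefficient `t b`, both cross terms become `-t b b⋆`, so `2t b b⋆ ≤ P + t² b Q b⋆`;
  -- applying `p` gives the scalar inequality with `u = p(b)²`.
  have h0 : 0 ≤ ∑ i ∈ s, inner 𝒜 (x i - (t : ℂ) • b • y i) (x i - (t : ℂ) • b • y i) :=
    Finset.sum_nonneg fun i _ => inner_self_nonneg _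
  have h1 : ∑ i ∈ s, inner 𝒜 (x i - (t : ℂ) • b • y i) (x i - (t : ℂ) • b • y i) =
      P + ((t ^ 2 : ℝ) : ℂ) • (b * Q * star b) - ((2 * t : ℝ) : ℂ) • (b * star b) := by
    simp only [P, Q, inner_sub_left, inner_sub_right, inner_complex_smul_left, inner_complex_smul_right,
      inner_smul_left, inner_smul_right, Finset.sum_sub_distrib, ← Finset.smul_sum,
      ← Finset.sum_mul, ← Finset.mul_sum, hb', ← hb]
    simp only [Complex.star_def, Complex.conj_ofReal, sq, two_mul, Complex.ofReal_mul,
      Complex.ofReal_add, add_smul, sub_mul, smul_sub, smul_mul_assoc, mul_smul]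
    abel
  rw [h1, sub_nonneg] at h0
  have h2 := ContCStarSeminorms.map_le_of_nonneg_of_le hp
    (ofReal_smul_nonneg (by positivity : 0 ≤ 2 * t) (mul_star_self_nonneg b)) h0
  have h3 := map_add_le_add p P (((t ^ 2 : ℝ) : ℂ) • (b * Q * star b))
  rw [map_smul_eq_mul, Complex.norm_real, Real.norm_of_nonneg (by positivity)] at h2 h3
  rw [ContCStarSeminorms.map_mul_star_self hp] at h2
  have h4 := mul_le_mul_of_nonneg_left (ContCStarSeminorms.map_conj_le hp b Q) (sq_nonneg t)
  linarith

theorem map_inner_le (hp : p ∈ ContCStarSeminorms 𝒜) (ξ η : X) :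
    p (inner 𝒜 ξ η) ≤ innerSeminorm p ξ * innerSeminorm p η := by
  have h := map_sum_inner_sq_le hp {()} (fun _ => ξ) (fun _ => η)
  simp only [Finset.sum_singleton, ← innerSeminorm_sq, ← mul_pow] at h
  exact le_of_sq_le_sq h (mul_nonneg (innerSeminorm_nonneg p ξ) (innerSeminorm_nonneg p η))

theorem innerSeminorm_add_le (hp : p ∈ ContCStarSeminorms 𝒜) (ξ η : X) :
    innerSeminorm p (ξ + η) ≤ innerSeminorm p ξ + innerSeminorm p η := by
  have h1 := innerSeminorm_nonneg p ξ
  have h2 := innerSeminorm_nonneg p η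
  refine le_of_sq_le_sq ?_ (add_nonneg h1 h2)
  rw [innerSeminorm_sq, inner_add_left, inner_add_right, inner_add_right]
  have h3 := map_add_le_add p (inner 𝒜 ξ ξ + inner 𝒜 ξ η) (inner 𝒜 η ξ + inner 𝒜 η η)
  have h4 := map_add_le_add p (inner 𝒜 ξ ξ) (inner 𝒜 ξ η)
  have h5 := map_add_le_add p (inner 𝒜 η ξ) (inner 𝒜 η η)
  have h6 := map_inner_le hp ξ η
  have h7 := map_inner_le hp η ξ
  rw [← innerSeminorm_sq] at h4 h5
  linarith

theorem innerSeminorm_sub_le (hp : p ∈ ContCStarSeminorms 𝒜) (ξ η : X) :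
    innerSeminorm p (ξ - η) ≤ innerSeminorm p ξ + innerSeminorm p η := by
  simpa [sub_eq_add_neg, innerSeminorm_neg] using innerSeminorm_add_le hp ξ (-η)

end HilbertProCStarModule

/-! ### Adjoints, a surjectivity criterion, and continuity of the inner product. -/

namespace HilbertProCStarModule

variable {𝒜 X I : Type*} [Ring 𝒜] [StarRing 𝒜] [Algebra ℂ 𝒜] [PartialOrder 𝒜] [UniformSpace 𝒜]
  [AddCommGroup X] [Module ℂ X] [Module 𝒜 X] [UniformSpace X] [HilbertProCStarModule 𝒜 X]

/-- A map with an adjoint is `𝒜`-linear. -/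
def linearMapOfAdjoint (F G : X → X) (h : ∀ ξ η : X, inner 𝒜 (F ξ) η = inner 𝒜 ξ (G η)) :
    X →ₗ[𝒜] X where
  toFun := F
  map_add' ξ ξ' := ext_inner_left (𝒜 := 𝒜) fun η => by
    rw [inner_add_left, h, h, h, inner_add_left]
  map_smul' a ξ := ext_inner_left (𝒜 := 𝒜) fun η => by
    rw [RingHom.id_apply, inner_smul_left, h, h, inner_smul_left]

theorem inner_adj_left (T : AdjointableOperator 𝒜 X X) (ξ η : X) :
    inner 𝒜 (T.adj ξ) η = inner 𝒜 ξ (T η) := by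
  rw [← star_inner, ← T.inner_adj, star_inner]

theorem adj_eq_self (S : AdjointableOperator 𝒜 X X)
    (h : ∀ ξ η : X, inner 𝒜 (S ξ) η = inner 𝒜 ξ (S η)) (ξ : X) : S.adj ξ = S ξ :=
  ext_inner_left (𝒜 := 𝒜) fun η => by rw [inner_adj_left, h]

variable [IsProCStarAlgebra 𝒜]

/-- A bounded operator that is bounded below by positive constants in each seminorm and has dense
range is surjective. -/
theorem surjective_of_forall_exists_lt (S : X →ₗ[𝒜] X) (hS : IsBoundedOperator S)
    (hlow : ∀ p ∈ ContCStarSeminorms 𝒜, ∃ C : ℝ, 0 < C ∧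
      ∀ ξ : X, innerSeminorm p ξ ≤ C * innerSeminorm p (S ξ))
    (hdense : ∀ p ∈ ContCStarSeminorms 𝒜, ∀ η : X, ∀ ε > 0, ∃ ξ : X,
      innerSeminorm p (S ξ - η) < ε) : Function.Surjective S := by
  have := toIsUniformAddGroup (𝒜 := 𝒜) (X := X)
  have := toCompleteSpace (𝒜 := 𝒜) (X := X)
  have := t2Space 𝒜 X
  -- The upper and lower bounds make `S` inducing, so its range inherits completeness and is closed.
  have hind : IsInducing S := by
    refine (IsTopologicalAddGroup.isInducing_iff_nhds_zero (f := S)).2 (le_antisymm ?_ ?_)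
    · rw [← tendsto_iff_comap, tendsto_zero_iff 𝒜]
      intro p hp
      obtain ⟨M, -, hM⟩ := hS p hp
      have h := ((tendsto_zero_iff 𝒜).1 (tendsto_id (x := 𝓝 (0 : X))) p hp).const_mul M
      rw [mul_zero] at h
      exact squeeze_zero (fun _ => innerSeminorm_nonneg _ _) hM h
    · have h : Tendsto (fun ξ => ξ) (comap S (𝓝 0)) (𝓝 (0 : X)) := by
        rw [tendsto_zero_iff 𝒜]
        intro p hp
        obtain ⟨C, -, hC⟩ := hlow p hp
        have h := ((tendsto_zero_iff 𝒜).1 (tendsto_comap (f := S) (x := 𝓝 (0 : X))) p hp).const_mul C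
        rw [mul_zero] at h
        exact squeeze_zero (fun _ => innerSeminorm_nonneg _ _) hC h
      exact h
  have huni := AddMonoidHom.isUniformInducing_of_isInducing hind
  have hcl : IsClosed (Set.range S) :=
    ((completeSpace_iff_isComplete_range huni).1 inferInstance).isClosed
  intro η
  rw [← Set.mem_range, ← hcl.closure_eq, mem_closure_iff_nhds]
  intro U hU
  have hU' : (fun ζ => ζ + η) ⁻¹' U ∈ 𝓝 (0 : X) :=
    (continuous_add_const η).continuousAt.preimage_mem_nhds (by rwa [zero_add])
  obtain ⟨p, hp, ε, hε, h⟩ := (mem_nhds_zero_iff 𝒜).1 hU'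
  obtain ⟨ξ, hξ⟩ := hdense p hp η ε hε
  exact ⟨S ξ, by simpa using h _ hξ, ξ, rfl⟩

variable [StarOrderedRing 𝒜]

theorem continuous_inner_right (ξ : X) : Continuous fun η : X => inner 𝒜 ξ η := by
  have := toIsUniformAddGroup (𝒜 := 𝒜) (X := X)
  refine continuous_of_tendsto_nhds_zero (innerAddHom 𝒜 ξ) ?_
  rw [IsProCStarAlgebra.nhds_zero_eq, tendsto_iInf]
  rintro ⟨p, hp⟩
  rw [tendsto_comap_iff]
  have h := ((tendsto_zero_iff 𝒜).1 (tendsto_id (x := 𝓝 (0 : X))) p hp).const_mul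
    (innerSeminorm p ξ)
  rw [mul_zero] at h
  exact squeeze_zero (fun _ => apply_nonneg _ _) (fun η => map_inner_le hp ξ η) h

theorem hasSum_inner_right (ξ : X) {x : I → X} {η : X} (h : HasSum x η) :
    HasSum (fun i => inner 𝒜 ξ (x i)) (inner 𝒜 ξ η) :=
  h.map (innerAddHom 𝒜 ξ) (continuous_inner_right ξ)

/-! ### Approximate solvability for coercive positive operators. -/

section Inverse

variable {p : Seminorm ℂ 𝒜}

/-- A positive bounded operator perturbed by a positive scalar has dense range, seminorm by
seminorm. -/
theorem exists_innerSeminorm_add_smul_sub_lt (hp : p ∈ ContCStarSeminorms 𝒜) (S : X →ₗ[𝒜] X)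
    (hpos : ∀ ξ : X, 0 ≤ inner 𝒜 (S ξ) ξ) (hsymm : ∀ ξ η : X, inner 𝒜 (S ξ) η = inner 𝒜 ξ (S η))
    {M : ℝ} (hM : 0 < M) (hS : ∀ ξ : X, innerSeminorm p (S ξ) ≤ M * innerSeminorm p ξ)
    {c : ℝ} (hc : 0 < c) (η : X) {ε : ℝ} (hε : 0 < ε) :
    ∃ ξ : X, innerSeminorm p (S ξ + (c : ℂ) • ξ - η) < ε := by
  have := toIsScalarTower (𝒜 := 𝒜) (X := X)
  -- This `t` minimises `(1 - tc)² + t²M²`, and the minimum is exactly `1 - tc = r < 1`.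
  set t : ℝ := c / (c ^ 2 + M ^ 2) with ht
  have hD : 0 < c ^ 2 + M ^ 2 := by positivity
  have ht0 : 0 < t := by positivity
  have htD : t * (c ^ 2 + M ^ 2) = c := div_mul_cancel₀ _ hD.ne'
  have htc : t * c ≤ 1 := by
    rw [ht, div_mul_eq_mul_div, div_le_one hD]
    nlinarith
  set r : ℝ := 1 - t * c with hr
  have hr0 : 0 ≤ r := by linarith
  have hr1 : r < 1 := by
    have : 0 < t * c := by positivity
    linarith
  -- Expanding the square, the cross term `-2rt⟨Sξ, ξ⟩` can be dropped because `S` is positive; this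
  -- leaves the factor `r² + t²M² = r`.
  have hK : ∀ ξ : X, innerSeminorm p ((r : ℂ) • ξ - (t : ℂ) • S ξ) ^ 2 ≤
      r * innerSeminorm p ξ ^ 2 := fun ξ => by
    have h1 : inner 𝒜 ((r : ℂ) • ξ - (t : ℂ) • S ξ) ((r : ℂ) • ξ - (t : ℂ) • S ξ) +
        ((2 * (r * t) : ℝ) : ℂ) • inner 𝒜 (S ξ) ξ =
        ((r ^ 2 : ℝ) : ℂ) • inner 𝒜 ξ ξ + ((t ^ 2 : ℝ) : ℂ) • inner 𝒜 (S ξ) (S ξ) := by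
      simp only [inner_sub_left, inner_sub_right, inner_complex_smul_left,
        inner_complex_smul_right, ← hsymm ξ ξ, Complex.star_def, Complex.conj_ofReal, sq, two_mul,
        Complex.ofReal_mul, Complex.ofReal_add, add_smul, smul_smul, smul_sub,
        mul_comm (t : ℂ) (r : ℂ)]
      abel
    have h2 := ContCStarSeminorms.map_le_of_nonneg_of_le hp
      (inner_self_nonneg (𝒜 := 𝒜) ((r : ℂ) • ξ - (t : ℂ) • S ξ))
      ((le_add_of_nonneg_right
        (ofReal_smul_nonneg (by positivity : 0 ≤ 2 * (r * t)) (hpos ξ))).trans_eq h1)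
    have h3 := map_add_le_add p (((r ^ 2 : ℝ) : ℂ) • inner 𝒜 ξ ξ)
      (((t ^ 2 : ℝ) : ℂ) • inner 𝒜 (S ξ) (S ξ))
    rw [map_smul_eq_mul, map_smul_eq_mul, Complex.norm_real, Complex.norm_real,
      Real.norm_of_nonneg (by positivity), Real.norm_of_nonneg (by positivity)] at h3
    simp only [← innerSeminorm_sq] at h2 h3
    have h4 := pow_le_pow_left₀ (innerSeminorm_nonneg p (S ξ)) (hS ξ) 2
    have h5 : r ^ 2 + t ^ 2 * M ^ 2 = r := by
      have : t * (t * (c ^ 2 + M ^ 2)) = t * c := by rw [htD]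
      rw [hr]
      linarith
    calc _ ≤ _ := h2.trans h3
      _ ≤ r ^ 2 * innerSeminorm p ξ ^ 2 + t ^ 2 * (M * innerSeminorm p ξ) ^ 2 := by gcongr
      _ = (r ^ 2 + t ^ 2 * M ^ 2) * innerSeminorm p ξ ^ 2 := by ring
      _ = _ := by rw [h5]
  -- Iterate `ξ ↦ ξ - te` with `e` the residual: the new residual is `re - tSe`, to which the
  -- contraction estimate applies.
  have key : ∀ n : ℕ, ∃ ξ : X, innerSeminorm p (S ξ + (c : ℂ) • ξ - η) ^ 2 ≤
      r ^ n * innerSeminorm p η ^ 2 := by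
    intro n
    induction n with
    | zero => exact ⟨0, by simp [innerSeminorm_neg]⟩
    | succ n ih =>
      obtain ⟨ξ, hξ⟩ := ih
      set e := S ξ + (c : ℂ) • ξ - η with he
      refine ⟨ξ - (t : ℂ) • e, ?_⟩
      have h1 : S (ξ - (t : ℂ) • e) + (c : ℂ) • (ξ - (t : ℂ) • e) - η =
          (r : ℂ) • e - (t : ℂ) • S e := by
        rw [map_sub, LinearMap.map_smul_of_tower, hr]
        push_cast
        rw [sub_smul, one_smul, mul_smul, smul_sub, smul_comm (t : ℂ) (c : ℂ) e]
        nth_rewrite 3 [he]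
        abel
      rw [h1, pow_succ' r, mul_assoc]
      exact (hK e).trans (mul_le_mul_of_nonneg_left hξ hr0)
  have hlim : Tendsto (fun n : ℕ => r ^ n * innerSeminorm p η ^ 2) atTop (𝓝 0) := by
    simpa using (tendsto_pow_atTop_nhds_zero_of_lt_one hr0 hr1).mul_const (innerSeminorm p η ^ 2)
  obtain ⟨n, hn⟩ := (hlim.eventually_lt_const (by positivity : 0 < ε ^ 2)).exists
  obtain ⟨ξ, hξ⟩ := key n
  exact ⟨ξ, lt_of_pow_lt_pow_left₀ 2 hε.le (hξ.trans_lt hn)⟩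

theorem exists_innerSeminorm_sub_lt (hp : p ∈ ContCStarSeminorms 𝒜) (S : X →ₗ[𝒜] X)
    (hpos : ∀ ξ : X, 0 ≤ inner 𝒜 (S ξ) ξ) (hsymm : ∀ ξ η : X, inner 𝒜 (S ξ) η = inner 𝒜 ξ (S η))
    {M : ℝ} (hM : 0 < M) (hS : ∀ ξ : X, innerSeminorm p (S ξ) ≤ M * innerSeminorm p ξ)
    {C : ℝ} (hC : 0 < C) (hlow : ∀ ξ : X, innerSeminorm p ξ ^ 2 ≤ C * p (inner 𝒜 (S ξ) ξ))
    (η : X) {ε : ℝ} (hε : 0 < ε) : ∃ ξ : X, innerSeminorm p (S ξ - η) < ε := by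
  have hη := innerSeminorm_nonneg p η
  -- An a priori bound for `p̄(ξ)` that does not involve `c`. It comes from `p̄(ξ)² ≤ C p(⟨Sξ, ξ⟩) ≤
  -- C p̄(ζ) p̄(ξ)`. Then `c` is chosen with `cb = ε/4`, for a total error of at most `ε/2 + ε/4`.
  set b := C * (innerSeminorm p η + ε / 2) with hb
  have hb0 : 0 < b := by positivity
  set c := ε / (4 * b) with hc
  have hc0 : 0 < c := by positivity
  obtain ⟨ξ, hξ⟩ := exists_innerSeminorm_add_smul_sub_lt hp S hpos hsymm hM hS hc0 η (half_pos hε)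
  set ζ := S ξ + (c : ℂ) • ξ with hζ
  refine ⟨ξ, ?_⟩
  have h0 := innerSeminorm_nonneg p ξ
  have h1 : p (inner 𝒜 (S ξ) ξ) ≤ innerSeminorm p ζ * innerSeminorm p ξ := by
    refine le_trans (ContCStarSeminorms.map_le_of_nonneg_of_le hp (hpos ξ) ?_)
      (map_inner_le hp ζ ξ)
    rw [hζ, inner_add_left, inner_complex_smul_left]
    exact le_add_of_nonneg_right (ofReal_smul_nonneg hc0.le (inner_self_nonneg ξ))
  have h2 : innerSeminorm p ζ ≤ innerSeminorm p η + ε / 2 := by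
    have := innerSeminorm_add_le hp (ζ - η) η
    rw [sub_add_cancel] at this
    linarith
  have h3 : innerSeminorm p ξ ≤ b := by
    rcases h0.eq_or_lt with h | h
    · exact h ▸ hb0.le
    · refine le_of_mul_le_mul_right ?_ h
      rw [← sq]
      refine (hlow ξ).trans ((mul_le_mul_of_nonneg_left h1 hC.le).trans ?_)
      rw [← mul_assoc, hb]
      gcongr
  have h4 : S ξ - η = (ζ - η) - (c : ℂ) • ξ := by rw [hζ]; abel
  have h5 := innerSeminorm_sub_le hp (ζ - η) ((c : ℂ) • ξ)
  rw [innerSeminorm_complex_smul, Complex.norm_real, Real.norm_of_nonneg hc0.le, ← h4] at h5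
  have h6 : c * innerSeminorm p ξ ≤ ε / 4 := by
    refine (mul_le_mul_of_nonneg_left h3 hc0.le).trans_eq ?_
    rw [hc]
    field_simp
  linarith

end Inverse

end HilbertProCStarModule

/-! ### The frame transform and the frame operator. -/

namespace IsStarOperatorFrame

open HilbertProCStarModule

variable {𝒜 X I : Type*} [Ring 𝒜] [StarRing 𝒜] [Algebra ℂ 𝒜] [PartialOrder 𝒜] [UniformSpace 𝒜]
  [AddCommGroup X] [Module ℂ X] [Module 𝒜 X] [UniformSpace X] [HilbertProCStarModule 𝒜 X]
  [StarOrderedRing 𝒜] [IsProCStarAlgebra 𝒜]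
  {T : I → AdjointableOperator 𝒜 X X} {A B : 𝒜ˣ} {p : Seminorm ℂ 𝒜}

/-- Finite sums of positive terms increase, so monotonicity and continuity of `p` bound them by `p`
of the full sum. -/
theorem map_sum_inner_self_le (hT : IsStarOperatorFrame T A B) (hp : p ∈ ContCStarSeminorms 𝒜)
    (s : Finset I) (ξ : X) :
    p (∑ i ∈ s, inner 𝒜 (T i ξ) (T i ξ)) ≤ p (B : 𝒜) ^ 2 * innerSeminorm p ξ ^ 2 := by
  obtain ⟨hsum, hA, hB⟩ := hT ξ
  have h0 : 0 ≤ ∑' i, inner 𝒜 (T i ξ) (T i ξ) :=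
    (star_right_conjugate_nonneg (inner_self_nonneg ξ) _).trans hA
  have hlim : Tendsto (fun t : Finset I => p (∑ i ∈ t, inner 𝒜 (T i ξ) (T i ξ))) atTop
      (𝓝 (p (∑' i, inner 𝒜 (T i ξ) (T i ξ)))) :=
    (hp.1.tendsto _).comp hsum.hasSum
  have h1 : p (∑ i ∈ s, inner 𝒜 (T i ξ) (T i ξ)) ≤ p (∑' i, inner 𝒜 (T i ξ) (T i ξ)) := by
    refine ge_of_tendsto hlim ((eventually_ge_atTop s).mono fun t hst => ?_)
    exact ContCStarSeminorms.map_le_of_nonneg_of_le hp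
      (Finset.sum_nonneg fun i _ => inner_self_nonneg _)
      (Finset.sum_le_sum_of_subset_of_nonneg hst fun i _ _ => inner_self_nonneg _)
  rw [innerSeminorm_sq]
  exact h1.trans ((ContCStarSeminorms.map_le_of_nonneg_of_le hp h0 hB).trans
    (ContCStarSeminorms.map_conj_le hp _ _))

/-- Duality: for the sum `ζ`, `⟨ζ, ζ⟩ = ∑ ⟨x_i, T_i ζ⟩`. Cauchy–Schwarz and the upper frame bound at
`ζ` leave a factor `p̄(ζ)²` to cancel. This is the Cauchy estimate for the adjoint series. -/
theorem innerSeminorm_sum_adj_sq_le (hT : IsStarOperatorFrame T A B)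
    (hp : p ∈ ContCStarSeminorms 𝒜) (s : Finset I) (x : I → X) :
    innerSeminorm p (∑ i ∈ s, (T i).adj (x i)) ^ 2 ≤
      p (∑ i ∈ s, inner 𝒜 (x i) (x i)) * p (B : 𝒜) ^ 2 := by
  set ζ := ∑ i ∈ s, (T i).adj (x i) with hζ
  have h1 : inner 𝒜 ζ ζ = ∑ i ∈ s, inner 𝒜 (x i) (T i ζ) := by
    conv_lhs => rw [hζ, inner_sum_left]
    exact Finset.sum_congr rfl fun i _ => inner_adj_left _ _ _
  have h2 := map_sum_inner_sq_le hp s x fun i => T i ζ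
  rw [← h1, ← innerSeminorm_sq] at h2
  have h3 := h2.trans (mul_le_mul_of_nonneg_left (hT.map_sum_inner_self_le hp s ζ)
    (apply_nonneg p _))
  rcases (innerSeminorm_nonneg p ζ).eq_or_lt with h | h
  · rw [← h]
    rw [zero_pow two_ne_zero]
    exact mul_nonneg (apply_nonneg p _) (sq_nonneg _)
  · refine le_of_mul_le_mul_right ?_ (pow_pos h 2)
    linarith

theorem summable_adj (hT : IsStarOperatorFrame T A B) (x : l2Families 𝒜 X I) :
    Summable fun i => (T i).adj (x.1 i) := by
  have := toIsUniformAddGroup (𝒜 := 𝒜) (X := X)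
  have := toCompleteSpace (𝒜 := 𝒜) (X := X)
  rw [summable_iff_vanishing]
  intro U hU
  obtain ⟨p, hp, ε, hε, h⟩ := (mem_nhds_zero_iff 𝒜).1 hU
  set b := p (B : 𝒜) ^ 2 with hb
  have hb0 : 0 ≤ b := sq_nonneg _
  -- The `+ 1` covers the case `p(B) = 0`.
  have hδ : 0 < ε ^ 2 / (b + 1) := by positivity
  have hV : {a : 𝒜 | p a < ε ^ 2 / (b + 1)} ∈ 𝓝 (0 : 𝒜) :=
    hp.1.continuousAt.eventually_lt_const (by rwa [map_zero])
  obtain ⟨s, hs⟩ := summable_iff_vanishing.1 x.2 _ hV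
  refine ⟨s, fun t ht => h _ (lt_of_pow_lt_pow_left₀ 2 hε.le ?_)⟩
  refine (hT.innerSeminorm_sum_adj_sq_le hp t x.1).trans_lt ?_
  have h1 : p (∑ i ∈ t, inner 𝒜 (x.1 i) (x.1 i)) < ε ^ 2 / (b + 1) := hs t ht
  rw [lt_div_iff₀ (by positivity)] at h1
  rcases (apply_nonneg p (∑ i ∈ t, inner 𝒜 (x.1 i) (x.1 i))).eq_or_lt with h2 | h2
  · rw [← h2, zero_mul]
    positivity
  · linarith

theorem isTransformAdjoint (hT : IsStarOperatorFrame T A B) :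
    IsTransformAdjoint T fun x : l2Families 𝒜 X I => ∑' i, (T i).adj (x.1 i) := fun ξ x => by
  have h := hasSum_inner_right (𝒜 := 𝒜) ξ (hT.summable_adj x).hasSum
  simp only [← AdjointableOperator.inner_adj] at h
  exact h

theorem hasSum_frameOperator (hT : IsStarOperatorFrame T A B) (ξ : X) :
    HasSum (fun i => (T i).adj (T i ξ)) (frameOperator T ξ) :=
  (hT.summable_adj ⟨_, (hT ξ).1⟩).hasSum

theorem hasSum_inner_frameOperator (hT : IsStarOperatorFrame T A B) (ξ η : X) :
    HasSum (fun i => inner 𝒜 (T i ξ) (T i η)) (inner 𝒜 ξ (frameOperator T η)) :=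
  hT.isTransformAdjoint ξ ⟨_, (hT η).1⟩

theorem inner_frameOperator_comm (hT : IsStarOperatorFrame T A B) (ξ η : X) :
    inner 𝒜 (frameOperator T ξ) η = inner 𝒜 ξ (frameOperator T η) := by
  have h := (hT.hasSum_inner_frameOperator η ξ).star
  simp only [star_inner] at h
  exact h.unique (hT.hasSum_inner_frameOperator ξ η)

theorem innerSeminorm_frameOperator_le (hT : IsStarOperatorFrame T A B)
    (hp : p ∈ ContCStarSeminorms 𝒜) (ξ : X) :
    innerSeminorm p (frameOperator T ξ) ≤ p (B : 𝒜) ^ 2 * innerSeminorm p ξ := by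
  set ζ := frameOperator T ξ with hζ
  have hξ0 := innerSeminorm_nonneg p ξ
  have hζ0 := innerSeminorm_nonneg p ζ
  have hlim : Tendsto (fun s : Finset I => p (∑ i ∈ s, inner 𝒜 (T i ζ) (T i ξ))) atTop
      (𝓝 (p (inner 𝒜 ζ ζ))) :=
    (hp.1.tendsto _).comp (hT.hasSum_inner_frameOperator ζ ξ)
  -- Cauchy–Schwarz on partial sums of `⟨ζ, Sξ⟩ = ∑ ⟨T_i ζ, T_i ξ⟩` with `ζ = Sξ`; the bound is
  -- uniform and passes to the limit.
  have h1 : p (inner 𝒜 ζ ζ) ≤ p (B : 𝒜) ^ 2 * innerSeminorm p ζ * innerSeminorm p ξ := by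
    refine le_of_tendsto' hlim fun s => le_of_sq_le_sq ?_ (by positivity)
    refine (map_sum_inner_sq_le hp s _ _).trans
      ((mul_le_mul (hT.map_sum_inner_self_le hp s ζ) (hT.map_sum_inner_self_le hp s ξ)
        (apply_nonneg _ _) (by positivity)).trans_eq ?_)
    ring
  rw [← innerSeminorm_sq] at h1
  rcases hζ0.eq_or_lt with h | h
  · rw [← h]
    positivity
  · refine le_of_mul_le_mul_right ?_ h
    linarith

theorem conj_le_inner_frameOperator (hT : IsStarOperatorFrame T A B) (ξ : X) :
    (A : 𝒜) * inner 𝒜 ξ ξ * star (A : 𝒜) ≤ inner 𝒜 (frameOperator T ξ) ξ := by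
  rw [hT.inner_frameOperator_comm, ← (hT.hasSum_inner_frameOperator ξ ξ).tsum_eq]
  exact (hT ξ).2.1

theorem inner_frameOperator_nonneg (hT : IsStarOperatorFrame T A B) (ξ : X) :
    0 ≤ inner 𝒜 (frameOperator T ξ) ξ :=
  (star_right_conjugate_nonneg (inner_self_nonneg ξ) _).trans (hT.conj_le_inner_frameOperator ξ)

theorem innerSeminorm_sq_le (hT : IsStarOperatorFrame T A B)
    (hp : p ∈ ContCStarSeminorms 𝒜) (ξ : X) :
    innerSeminorm p ξ ^ 2 ≤
      p ((A⁻¹ : 𝒜ˣ) : 𝒜) ^ 2 * p (inner 𝒜 (frameOperator T ξ) ξ) := by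
  have h1 : inner 𝒜 ξ ξ = ((A⁻¹ : 𝒜ˣ) : 𝒜) * ((A : 𝒜) * inner 𝒜 ξ ξ * star (A : 𝒜)) *
      star ((A⁻¹ : 𝒜ˣ) : 𝒜) := by
    rw [mul_assoc, mul_assoc _ (star (A : 𝒜)), ← star_mul, Units.inv_mul, star_one, mul_one,
      Units.inv_mul_cancel_left]
  rw [innerSeminorm_sq, h1]
  exact (ContCStarSeminorms.map_conj_le hp _ _).trans (mul_le_mul_of_nonneg_left
    (ContCStarSeminorms.map_le_of_nonneg_of_le hp
      (star_right_conjugate_nonneg (inner_self_nonneg ξ) _)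
      (hT.conj_le_inner_frameOperator ξ)) (sq_nonneg _))

theorem innerSeminorm_le (hT : IsStarOperatorFrame T A B)
    (hp : p ∈ ContCStarSeminorms 𝒜) (ξ : X) :
    innerSeminorm p ξ ≤ p ((A⁻¹ : 𝒜ˣ) : 𝒜) ^ 2 * innerSeminorm p (frameOperator T ξ) := by
  have h1 := (hT.innerSeminorm_sq_le hp ξ).trans
    (mul_le_mul_of_nonneg_left (map_inner_le hp (frameOperator T ξ) ξ) (sq_nonneg _))
  rcases (innerSeminorm_nonneg p ξ).eq_or_lt with h | h
  · rw [← h]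
    have := innerSeminorm_nonneg p (frameOperator T ξ)
    positivity
  · refine le_of_mul_le_mul_right ?_ h
    linarith

/-- The frame operator as an adjointable operator. -/
noncomputable def toAdjointableOperator (hT : IsStarOperatorFrame T A B) :
    AdjointableOperator 𝒜 X X where
  toLinearMap := linearMapOfAdjoint _ _ hT.inner_frameOperator_comm
  bounded p hp := ⟨p (B : 𝒜) ^ 2 + 1, by positivity, fun ξ =>
    (hT.innerSeminorm_frameOperator_le hp ξ).trans
      (mul_le_mul_of_nonneg_right (by linarith) (innerSeminorm_nonneg p ξ))⟩
  adjointable := ⟨_, hT.inner_frameOperator_comm⟩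

theorem surjective_frameOperator (hT : IsStarOperatorFrame T A B) :
    Function.Surjective (frameOperator T) := by
  let S := hT.toAdjointableOperator
  have hC : ∀ p : Seminorm ℂ 𝒜, 0 < p ((A⁻¹ : 𝒜ˣ) : 𝒜) ^ 2 + 1 := fun p => by positivity
  refine surjective_of_forall_exists_lt S.toLinearMap S.bounded (fun p hp => ⟨_, hC p, fun ξ =>
    (hT.innerSeminorm_le hp ξ).trans (mul_le_mul_of_nonneg_right (by linarith)
      (innerSeminorm_nonneg p _))⟩) fun p hp η ε hε => ?_
  obtain ⟨M, hM, hS⟩ := S.bounded p hp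
  exact exists_innerSeminorm_sub_lt hp S.toLinearMap hT.inner_frameOperator_nonneg
    hT.inner_frameOperator_comm hM hS (hC p) (fun ξ => (hT.innerSeminorm_sq_le hp ξ).trans
      (mul_le_mul_of_nonneg_right (by linarith) (apply_nonneg p _))) η hε

/-- A set-theoretic right inverse `G` is symmetric because `S` is: `⟨Gξ, η⟩ = ⟨Gξ, SGη⟩ = ⟨SGξ, Gη⟩
= ⟨ξ, Gη⟩`. Symmetry supplies linearity and the adjoint, and makes `G` a left inverse too. -/
theorem exists_inverse (hT : IsStarOperatorFrame T A B) :
    ∃ S' : AdjointableOperator 𝒜 X X,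
      (∀ ξ : X, frameOperator T (S' ξ) = ξ) ∧ ∀ ξ : X, S' (frameOperator T ξ) = ξ := by
  obtain ⟨G, hG⟩ := hT.surjective_frameOperator.hasRightInverse
  have hadj : ∀ ξ η : X, inner 𝒜 (G ξ) η = inner 𝒜 ξ (G η) := fun ξ η => by
    conv_lhs => rw [← hG η, ← hT.inner_frameOperator_comm, hG ξ]
  refine ⟨⟨linearMapOfAdjoint _ _ hadj, fun p hp => ⟨p ((A⁻¹ : 𝒜ˣ) : 𝒜) ^ 2 + 1, by positivity,
    fun ξ => ?_⟩, _, hadj⟩, hG, fun ξ => ?_⟩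
  · refine (hT.innerSeminorm_le hp (G ξ)).trans ?_
    rw [hG ξ]
    exact mul_le_mul_of_nonneg_right (by linarith) (innerSeminorm_nonneg p ξ)
  · refine ext_inner_left (𝒜 := 𝒜) fun η => ?_
    change inner 𝒜 (G (frameOperator T ξ)) η = inner 𝒜 ξ η
    rw [hadj, hT.inner_frameOperator_comm, hG η]

theorem opSeminorm_le (hT : IsStarOperatorFrame T A B) (hp : p ∈ ContCStarSeminorms 𝒜) :
    hT.toAdjointableOperator.opSeminorm p ≤ p (B : 𝒜) ^ 2 := by
  refine csSup_le ⟨_, 0, by simp [innerSeminorm_zero], rfl⟩ ?_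
  rintro _ ⟨ξ, hξ, rfl⟩
  exact (hT.innerSeminorm_frameOperator_le hp ξ).trans (mul_le_of_le_one_right (sq_nonneg _) hξ)

theorem inv_le_opSeminorm (hT : IsStarOperatorFrame T A B) (hp : p ∈ ContCStarSeminorms 𝒜)
    (h : ∃ ξ : X, innerSeminorm p ξ ≠ 0) :
    (p ((A⁻¹ : 𝒜ˣ) : 𝒜) ^ 2)⁻¹ ≤ hT.toAdjointableOperator.opSeminorm p := by
  obtain ⟨ξ, hξ⟩ := h
  -- A vector with `p̄(η) = 1` turns the lower estimate into `1 ≤ p(A⁻¹)² p̄(Sη)`, which also forces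
  -- `p(A⁻¹) ≠ 0`.
  set η := (((innerSeminorm p ξ)⁻¹ : ℝ) : ℂ) • ξ with hη
  have h1 : innerSeminorm p η = 1 := by
    rw [hη, innerSeminorm_complex_smul, Complex.norm_real,
      Real.norm_of_nonneg (inv_nonneg.2 (innerSeminorm_nonneg p ξ)), inv_mul_cancel₀ hξ]
  have hbdd : BddAbove {r : ℝ | ∃ ξ : X, innerSeminorm p ξ ≤ 1 ∧
      r = innerSeminorm p (hT.toAdjointableOperator ξ)} := by
    refine ⟨p (B : 𝒜) ^ 2, ?_⟩
    rintro _ ⟨ξ, hξ, rfl⟩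
    exact (hT.innerSeminorm_frameOperator_le hp ξ).trans (mul_le_of_le_one_right (sq_nonneg _) hξ)
  refine le_trans ?_ (le_csSup hbdd ⟨η, h1.le, rfl⟩)
  have h2 := hT.innerSeminorm_le hp η
  rw [h1] at h2
  have h3 : 0 < p ((A⁻¹ : 𝒜ˣ) : 𝒜) ^ 2 := by
    refine (sq_nonneg _).lt_of_ne fun h0 => ?_
    rw [← h0, zero_mul] at h2
    linarith
  exact (inv_le_iff_one_le_mul₀' h3).2 h2

end IsStarOperatorFrame

theorem theorem3p7 {𝒜 X I : Type*}
    [Ring 𝒜] [StarRing 𝒜] [Algebra ℂ 𝒜] [PartialOrder 𝒜] [StarOrderedRing 𝒜]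
    [UniformSpace 𝒜] [IsProCStarAlgebra 𝒜]
    [AddCommGroup X] [Module ℂ X] [Module 𝒜 X] [UniformSpace X] [HilbertProCStarModule 𝒜 X]
    [Countable I] (T : I → AdjointableOperator 𝒜 X X) (A B : 𝒜ˣ)
    (hT : IsStarOperatorFrame T A B) :
    ∃ S : AdjointableOperator 𝒜 X X,
      -- `S` is the frame operator: `S = R⋆R = ∑ T_i⋆ T_i`, the series converging pointwise
      (∀ ξ : X, S ξ = frameOperator T ξ) ∧
      (∀ ξ : X, HasSum (fun i => (T i).adj (T i ξ)) (S ξ)) ∧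
      (∃ (hR : ∀ ξ : X, frameTransform T ξ ∈ l2Families 𝒜 X I) (R' : l2Families 𝒜 X I → X),
        IsTransformAdjoint T R' ∧ ∀ ξ : X, S ξ = R' ⟨frameTransform T ξ, hR ξ⟩) ∧
      -- bounded
      IsBoundedOperator S.toLinearMap ∧
      -- positive
      (∀ ξ : X, 0 ≤ inner 𝒜 (S ξ) ξ) ∧
      -- self-adjoint
      (∀ ξ : X, S.adj ξ = S ξ) ∧
      -- invertible in `Hom⋆_𝒜(X)`
      (∃ S' : AdjointableOperator 𝒜 X X, (∀ ξ : X, S (S' ξ) = ξ) ∧ ∀ ξ : X, S' (S ξ) = ξ) ∧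
      -- upper bound, and lower bound for the `p` for which `p̄` does not vanish on `X`
      (∀ p ∈ ContCStarSeminorms 𝒜, S.opSeminorm p ≤ p (B : 𝒜) ^ 2) ∧
      (∀ p ∈ ContCStarSeminorms 𝒜, (∃ ξ : X, innerSeminorm p ξ ≠ 0) →
        (p ((A⁻¹ : 𝒜ˣ) : 𝒜) ^ 2)⁻¹ ≤ S.opSeminorm p) := by

  refine ⟨hT.toAdjointableOperator, fun _ => rfl, hT.hasSum_frameOperator,
    ⟨fun ξ => (hT ξ).1, _, hT.isTransformAdjoint, fun _ => rfl⟩,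
    hT.toAdjointableOperator.bounded, hT.inner_frameOperator_nonneg,
    HilbertProCStarModule.adj_eq_self _ hT.inner_frameOperator_comm, hT.exists_inverse,
    fun _ hp => hT.opSeminorm_le hp, fun _ hp h => hT.inv_le_opSeminorm hp h⟩
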